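/- Let $\bar q>0$ and let $\pi:[0,\bar q]^2\to\mathbb R$ be twice continuously differentiable with $\pi_{11}<\pi_{12}<0$ on $[0,\bar q]^2$ and $\pi_1(0,0)>0$, and suppose that the monopoly quantity, i.e. the maximizer of $q\mapsto\pi(q,0)$ on $[0,\bar q]$, is smaller than $\bar q$. Here $\pi(q_i,q_{-i})$ is the profit of a firm that produces $q_i$ when the other firm produces $q_{-i}$. Let $R(q)$ be the unique maximizer of $\pi(\cdot,q)$ on $[0,\bar q]$, let $q^l$ be any maximizer of $q\mapsto\pi(q,R(q))$ on $[0,\bar q]$, and let $q^f=R(q^l)$. A signal consists of two nondecreasing differentiable functions $g_0,g_1:[0,\bar q]\to\mathbb R$ with $g_0(q)<q<g_1(q)$ for all $q$, and a jointly continuous $g:[0,\bar q]\times\mathbb R\to[0,\infty)$ such that each $g(q,\cdot)$ is a probability density and $g(q,x)>0$ if and only if $g_0(q)<x<g_1(q)$. In the associated game the leader chooses $q_1\in[0,\bar q]$; the follower observes only a signal $s$ with density $g(q_1,\cdot)$ and chooses $q_2\in[0,\bar q]$; the payoffs are $\pi(q_1,q_2)$ for the leader and $\pi(q_2,q_1)$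 for the follower. Let $\mu$ be any Borel probability measure on $\mathbb R$ with respect to which the signal distributions have densities $h(q,\cdot)\ge 0$, where $h$ is measurable, continuous in $q$ for each $s$, and bounded by a $\mu$-integrable function of $s$. A strategic measure of the leader is a Borel probability measure $m_1$ on $[0,\bar q]$. A strategic measure of the follower is a probability measure on $\mathbb R\times[0,\bar q]$ of the form $m_2(ds,dq_2)=\mu(ds)\,\beta(s,dq_2)$ with a Markov kernel $\beta$. The profile $(m_1,m_2)$ induces the distribution $h(q_1,s)\,m_1(dq_1)\,m_2(ds,dq_2)$ over plays $(q_1,s,q_2)$. A measurable set $F\subseteq\mathbb R$ of signals is strategically relevant if it is reached with positive probability under some profile. A profile $m$ of strategic measures is a sequential equilibrium if it is the weak limit of a sequence of profiles $m^n$ of strategic measures such that every strategically relevant $F$ is reached with positive probability under every $m^n$ and, for every $\eta>0$, for all but finitely many $n$: $m^n_1$ is $\eta$-optimal for the leader against $m^n_2$, and for every strategically relevant $F$, the follower's conditional expected payoff given $s\in F$ under $(m^n_1,m^n_2)$ exceeds, for every strategic measure $m_2'$ of the follower, the one under $(m^n_1,m_2')$ minus $\eta$. Fix $\bar q$ and $\pi$.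 For every $\varepsilon>0$ there is $\delta>0$ such that for every signal $(g,g_0,g_1)$ with $|g_1(q)-g_0(q)|\le\delta$ for all $q\in[0,\bar q]$ (and every $\mu,h$ as above), the leader's expected payoff in every sequential equilibrium is at least $\pi(q^l,q^f)-\varepsilon$. -/

import Mathlib

open MeasureTheory ProbabilityTheory Set Filter Topology

namespace NoisyDuopoly

noncomputable section

/-! ### The duopoly -/

/-- The quantities `[0, qbar]` available to either firm. -/
abbrev Quantity (qbar : ℝ) : Type := Set.Icc (0 : ℝ) qbar

/-- The partial derivative `π₁` on `[0, qbar]²` (one-sided at the boundary). -/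
def partial1 (qbar : ℝ) (π : ℝ → ℝ → ℝ) (x y : ℝ) : ℝ :=
  derivWithin (fun t => π t y) (Icc 0 qbar) x

/-- The partial derivative `π₁₁`. -/
def partial11 (qbar : ℝ) (π : ℝ → ℝ → ℝ) (x y : ℝ) : ℝ :=
  derivWithin (fun t => partial1 qbar π t y) (Icc 0 qbar) x

/-- The partial derivative `π₁₂`. -/
def partial12 (qbar : ℝ) (π : ℝ → ℝ → ℝ) (x y : ℝ) : ℝ :=
  derivWithin (fun t => partial1 qbar π x t) (Icc 0 qbar) y

/-- The standing assumptions on the profit `π own other` of a firm. Only the values of `π` on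
`[0, qbar]²` matter. -/
structure IsProfit (qbar : ℝ) (π : ℝ → ℝ → ℝ) : Prop where
  contDiffOn : ContDiffOn ℝ 2 (Function.uncurry π) (Icc 0 qbar ×ˢ Icc 0 qbar)
  partial11_lt : ∀ x ∈ Icc 0 qbar, ∀ y ∈ Icc 0 qbar, partial11 qbar π x y < partial12 qbar π x y
  partial12_neg : ∀ x ∈ Icc 0 qbar, ∀ y ∈ Icc 0 qbar, partial12 qbar π x y < 0
  marginal_pos : 0 < partial1 qbar π 0 0
  /-- `qbar` is larger than the quantity that a monopolist would choose. -/
  monopoly_lt : ∃ qM ∈ Ico 0 qbar, IsMaxOn (fun q => π q 0) (Icc 0 qbar) qM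

/-- `R` is the reaction function: `R q` is a best response in `[0, qbar]` to `q`. -/
def IsReaction (qbar : ℝ) (π : ℝ → ℝ → ℝ) (R : ℝ → ℝ) : Prop :=
  ∀ q ∈ Icc 0 qbar, R q ∈ Icc 0 qbar ∧ IsMaxOn (fun r => π r q) (Icc 0 qbar) (R q)

/-- `ql` is an optimal quantity of the leader under perfect observability. -/
def IsLeaderQuantity (qbar : ℝ) (π : ℝ → ℝ → ℝ) (R : ℝ → ℝ) (ql : ℝ) : Prop :=
  ql ∈ Icc 0 qbar ∧ IsMaxOn (fun q => π q (R q)) (Icc 0 qbar) ql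

/-- The noisy signal: given the leader's quantity `q`, it has the Lebesgue density `g q`, which is
positive exactly on `(g0 q, g1 q)`. -/
structure IsSignal (qbar : ℝ) (g : ℝ → ℝ → ℝ) (g0 g1 : ℝ → ℝ) : Prop where
  continuousOn : ContinuousOn (Function.uncurry g) (Icc 0 qbar ×ˢ univ)
  nonneg : ∀ q ∈ Icc 0 qbar, ∀ x, 0 ≤ g q x
  integral_eq_one : ∀ q ∈ Icc 0 qbar, ∫ x, g q x = 1
  monotoneOn_g0 : MonotoneOn g0 (Icc 0 qbar)
  monotoneOn_g1 : MonotoneOn g1 (Icc 0 qbar)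
  differentiableOn_g0 : DifferentiableOn ℝ g0 (Icc 0 qbar)
  differentiableOn_g1 : DifferentiableOn ℝ g1 (Icc 0 qbar)
  g0_lt : ∀ q ∈ Icc 0 qbar, g0 q < q
  lt_g1 : ∀ q ∈ Icc 0 qbar, q < g1 q
  pos_iff : ∀ q ∈ Icc 0 qbar, ∀ x, 0 < g q x ↔ g0 q < x ∧ x < g1 q

/-- The conditional distribution of the signal given the leader's quantity. -/
def signalLaw {qbar : ℝ} (g : ℝ → ℝ → ℝ) (q : Quantity qbar) : Measure ℝ :=
  volume.withDensity fun x => ENNReal.ofReal (g q x)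

/-- The signal distributions are represented by a reference probability measure `μ` on the signal
space and an integrably bounded family `h` of conditional densities with respect to `μ` that is
continuous in the leader's quantity. -/
structure IsDensity {qbar : ℝ} (g : ℝ → ℝ → ℝ) (μ : ProbabilityMeasure ℝ)
    (h : Quantity qbar → ℝ → ℝ) : Prop where
  measurable : Measurable (Function.uncurry h)
  nonneg : ∀ q s, 0 ≤ h q s
  continuous : ∀ s, Continuous fun q => h q s
  bounded : ∃ f : ℝ → ℝ, Measurable f ∧ Integrable f (μ : Measure ℝ) ∧ ∀ q s, h q s ≤ f s
  signalLaw_eq : ∀ q, signalLaw g q = (μ : Measure ℝ).withDensity fun s => ENNReal.ofReal (h q s)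

/-! ### Strategic measures and sequential equilibrium

The leader moves once, without any information, so a strategic measure of the leader is a
distribution of quantities. The follower moves once, after the signal, so a strategic measure of
the follower is a distribution of pairs (signal, quantity). -/

/-- Pairs of a distribution on `[0, qbar]` and a distribution on `ℝ × [0, qbar]`, with the
topology of weak convergence in both coordinates. -/
abbrev Profile (qbar : ℝ) : Type :=
  ProbabilityMeasure (Quantity qbar) × ProbabilityMeasure (ℝ × Quantity qbar)

/-- `m` is a strategic measure of the follower: it is induced by a behavior strategy `β`, with the
signal drawn from the reference measure `μ`. -/
def IsFollowerStrategic {qbar : ℝ} (μ : ProbabilityMeasure ℝ)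
    (m : ProbabilityMeasure (ℝ × Quantity qbar)) : Prop :=
  ∃ β : Kernel ℝ (Quantity qbar), IsMarkovKernel β ∧
    (m : Measure (ℝ × Quantity qbar)) = (μ : Measure ℝ) ⊗ₘ β

/-- `m` is a profile of strategic measures. Every distribution on `[0, qbar]` is a strategic
measure of the leader. -/
def IsStrategic {qbar : ℝ} (μ : ProbabilityMeasure ℝ) (m : Profile qbar) : Prop :=
  IsFollowerStrategic μ m.2

/-- The distribution over plays (leader's quantity, signal, follower's quantity): the density `h`
turns the independent signal of the strategic measures into the actual one. -/
def playLaw {qbar : ℝ} (h : Quantity qbar → ℝ → ℝ) (m : Profile qbar) :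
    Measure (Quantity qbar × ℝ × Quantity qbar) :=
  ((m.1 : Measure (Quantity qbar)).prod (m.2 : Measure (ℝ × Quantity qbar))).withDensity
    fun p => ENNReal.ofReal (h p.1 p.2.1)

/-- The plays at which the follower receives a signal in `F`. -/
def playsThrough (qbar : ℝ) (F : Set ℝ) : Set (Quantity qbar × ℝ × Quantity qbar) :=
  {p | p.2.1 ∈ F}

/-- The expected payoff of the leader. -/
def leaderPayoff {qbar : ℝ} (π : ℝ → ℝ → ℝ) (h : Quantity qbar → ℝ → ℝ) (m : Profile qbar) : ℝ :=
  ∫ p, π p.1 p.2.2 ∂(playLaw h m)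

/-- The conditional expected payoff of the follower given that the signal lies in `F`. -/
def followerPayoffGiven {qbar : ℝ} (π : ℝ → ℝ → ℝ) (h : Quantity qbar → ℝ → ℝ) (m : Profile qbar)
    (F : Set ℝ) : ℝ :=
  ∫ p, π p.2.2 p.1 ∂(ProbabilityTheory.cond (playLaw h m) (playsThrough qbar F))

/-- `F` is reached with positive probability under `m`. -/
def Reached {qbar : ℝ} (h : Quantity qbar → ℝ → ℝ) (m : Profile qbar) (F : Set ℝ) : Prop :=
  0 < playLaw h m (playsThrough qbar F)

/-- `F` is strategically relevant to the follower: a measurable set of signals that is reached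
with positive probability under some profile. The follower has no own past actions, so there is no
openness condition. -/
def IsRelevant {qbar : ℝ} (μ : ProbabilityMeasure ℝ) (h : Quantity qbar → ℝ → ℝ)
    (F : Set ℝ) : Prop :=
  MeasurableSet F ∧ ∃ m : Profile qbar, IsStrategic μ m ∧ Reached h m F

/-- `ε`-optimality of the leader. The leader has a single information set, which is always
reached, and every strategic measure of the leader is a continuation there. -/
def LeaderOptimal {qbar : ℝ} (π : ℝ → ℝ → ℝ) (h : Quantity qbar → ℝ → ℝ) (m : Profile qbar)
    (ε : ℝ) : Prop :=
  ∀ m₁ : ProbabilityMeasure (Quantity qbar), leaderPayoff π h (m₁, m.2) - ε < leaderPayoff π h m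

/-- `ε`-optimality of the follower at the set `F` of signals. Since the follower has not moved
before, every strategic measure of the follower is a continuation. -/
def FollowerOptimalAt {qbar : ℝ} (π : ℝ → ℝ → ℝ) (μ : ProbabilityMeasure ℝ)
    (h : Quantity qbar → ℝ → ℝ) (m : Profile qbar) (F : Set ℝ) (ε : ℝ) : Prop :=
  ∀ m₂ : ProbabilityMeasure (ℝ × Quantity qbar), IsFollowerStrategic μ m₂ →
    followerPayoffGiven π h (m.1, m₂) F - ε < followerPayoffGiven π h m F

/-- `m` is a sequential equilibrium: the limit of profiles of strategic measures that reach every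
strategically relevant set with positive probability and that are, for every `ε > 0`, eventually
`ε`-optimal at all strategically relevant sets. -/
def IsSequentialEquilibrium {qbar : ℝ} (π : ℝ → ℝ → ℝ) (μ : ProbabilityMeasure ℝ)
    (h : Quantity qbar → ℝ → ℝ) (m : Profile qbar) : Prop :=
  IsStrategic μ m ∧ ∃ u : ℕ → Profile qbar,
    (∀ n, IsStrategic μ (u n)) ∧
    Tendsto u atTop (𝓝 m) ∧
    (∀ n F, IsRelevant (qbar := qbar) μ h F → Reached h (u n) F) ∧
    ∀ ε > 0, ∀ᶠ n in atTop, LeaderOptimal π h (u n) ε ∧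
      ∀ F, IsRelevant (qbar := qbar) μ h F → FollowerOptimalAt π μ h (u n) F ε

end

end NoisyDuopoly

/-! Suppose the leader deviates to q = `ql`. Almost every signal s with `h q s > 0` is within δ of
q, and under any profile the signal is almost surely within δ of the quantity actually produced.
Hence, given a set of such signals, the leader's quantity lies within 2δ of q, whatever the leader's
strategy. A set of such signals with positive `μ`-measure is strategically relevant, so the
approximating profiles must reach it, and the follower must be nearly optimal there, even if the
limit avoids q. Taking for this set the signals at which the regret against q is large gives a
contradiction (`ae_integral_regret_neg`). Small regret forces a response nearly as good for the
leader as R(q): R(q) is the only best reply, by strict concavity, and `exists_tradeoff` makes this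
quantitative in a form that can be averaged over mixed responses. The leader's near-optimality
against the deviation to q then bounds the approximating payoffs from below. The bound passes to the
limit by `tendsto_leaderPayoff`, where weak convergence alone would not do, as `h` is merely
measurable in the signal; the fixed signal marginal `μ` makes up for it. -/

namespace NoisyDuopoly

/-! ### Concavity of the profit and uniqueness of best replies -/

section Profit

variable {qbar : ℝ} {π : ℝ → ℝ → ℝ}

theorem IsProfit.continuous (hπ : IsProfit qbar π) :
    Continuous fun p : Quantity qbar × Quantity qbar => π p.1 p.2 :=
  hπ.contDiffOn.continuousOn.comp_continuous
    (f := fun p : Quantity qbar × Quantity qbar => ((p.1 : ℝ), (p.2 : ℝ)))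
    (by fun_prop) (fun p => ⟨p.1.2, p.2.2⟩)

/-- The chain π₁₁ < π₁₂ < 0 makes the second derivative negative. Only interior points matter, and
there the one-sided derivatives are ordinary ones. -/
theorem IsProfit.strictConcaveOn (hπ : IsProfit qbar π) {y : ℝ} (hy : y ∈ Icc 0 qbar) :
    StrictConcaveOn ℝ (Icc 0 qbar) fun x => π x y := by
  have key : ∀ f : ℝ → ℝ, ∀ x ∈ Ioo 0 qbar, derivWithin f (Icc 0 qbar) x = deriv f x :=
    fun f x hx => derivWithin_of_mem_nhds (Icc_mem_nhds hx.1 hx.2)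
  refine strictConcaveOn_of_deriv2_neg (convex_Icc _ _) ?_ ?_
  · exact hπ.contDiffOn.continuousOn.comp (f := fun x : ℝ => (x, y)) (by fun_prop)
      (fun x hx => ⟨hx, hy⟩)
  · intro x hx
    rw [interior_Icc] at hx
    have : deriv^[2] (fun x => π x y) x = partial11 qbar π x y := by
      rw [partial11, key _ x hx]
      change deriv (deriv fun x => π x y) x = _
      apply Filter.EventuallyEq.deriv_eq
      filter_upwards [Ioo_mem_nhds hx.1 hx.2] with t ht
      exact (key _ t ht).symm
    rw [this]
    have hx' := Ioo_subset_Icc_self hx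
    exact (hπ.partial11_lt x hx' y hy).trans (hπ.partial12_neg x hx' y hy)

theorem IsProfit.eq_of_isMaxOn (hπ : IsProfit qbar π) {x x' y : ℝ} (hx : x ∈ Icc 0 qbar)
    (hx' : x' ∈ Icc 0 qbar) (hy : y ∈ Icc 0 qbar)
    (h : IsMaxOn (fun t => π t y) (Icc 0 qbar) x) (h' : IsMaxOn (fun t => π t y) (Icc 0 qbar) x') :
    x = x' :=
  (hπ.strictConcaveOn hy).eq_of_isMaxOn h h' hx hx'

end Profit

/-- If `r` is the only maximizer of `f`, then a point can make `g` fall short of `g r` only at the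
expense of `f`. -/
theorem exists_tradeoff {X : Type*} [TopologicalSpace X] [CompactSpace X] {f g : X → ℝ}
    (hf : Continuous f) (hg : Continuous g) {r : X} (hr : ∀ x, f x ≤ f r)
    (huniq : ∀ x, f x = f r → x = r) {ε : ℝ} (hε : 0 < ε) :
    ∃ K : ℝ, 0 ≤ K ∧ ∀ x, g r - ε - K * (f r - f x) ≤ g x := by
  rcases ({x | g x ≤ g r - ε} : Set X).eq_empty_or_nonempty with h | h
  · refine ⟨0, le_rfl, fun x => ?_⟩
    have : ¬ g x ≤ g r - ε := fun hx => by
      have : x ∈ ({x | g x ≤ g r - ε} : Set X) := hx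
      simp [h] at this
    linarith
  · have hc : IsCompact {x | g x ≤ g r - ε} := (isClosed_le hg continuous_const).isCompact
    obtain ⟨a, ha, hamax⟩ := hc.exists_isMaxOn h hf.continuousOn
    obtain ⟨b, -, hb⟩ := isCompact_univ.exists_isMinOn ⟨r, mem_univ r⟩ hg.continuousOn
    have ha' : g a ≤ g r - ε := ha
    -- By compactness and uniqueness, the points bad for `g` lose at least a fixed positive amount
    -- of `f`. The range of `g` below `g r`, divided by this gap, serves as K.
    have hpos : 0 < f r - f a := by
      refine sub_pos.2 ((hr a).lt_of_ne fun h => ?_)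
      rw [huniq a h] at ha'
      linarith
    have hbr : g b ≤ g r := hb (mem_univ r)
    have hK : 0 ≤ (g r - g b) / (f r - f a) := div_nonneg (by linarith) hpos.le
    refine ⟨_, hK, fun x => ?_⟩
    by_cases hx : g x ≤ g r - ε
    · have h1 : f x ≤ f a := hamax hx
      have h2 : g b ≤ g x := hb (mem_univ x)
      have h3 := mul_le_mul_of_nonneg_left (show f r - f a ≤ f r - f x by linarith) hK
      rw [div_mul_cancel₀ _ hpos.ne'] at h3
      linarith
    · have := mul_nonneg hK (sub_nonneg.2 (hr x))
      linarith

/-! ### Signals and the law of plays -/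

section Signal

variable {qbar : ℝ} {g : ℝ → ℝ → ℝ} {g0 g1 : ℝ → ℝ} {μ : ProbabilityMeasure ℝ}
  {h : Quantity qbar → ℝ → ℝ}

theorem IsSignal.signalLaw_univ (hg : IsSignal qbar g g0 g1) (q : Quantity qbar) :
    signalLaw g q univ = 1 := by
  have h1 := hg.integral_eq_one q q.2
  rw [signalLaw, withDensity_apply _ MeasurableSet.univ, setLIntegral_univ,
    ← ofReal_integral_eq_lintegral_ofReal (integrable_of_integral_eq_one h1)
      (ae_of_all _ (hg.nonneg q q.2)), h1, ENNReal.ofReal_one]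

theorem IsSignal.ae_abs_sub_lt (hg : IsSignal qbar g g0 g1) {δ : ℝ}
    (hδ : ∀ q ∈ Icc 0 qbar, |g1 q - g0 q| ≤ δ) (q : Quantity qbar) :
    ∀ᵐ s ∂(signalLaw g q), |s - (q : ℝ)| < δ := by
  have hcont : Continuous (g q) :=
    hg.continuousOn.comp_continuous (f := fun x : ℝ => ((q : ℝ), x)) (by fun_prop)
      (fun x => ⟨q.2, mem_univ x⟩)
  rw [signalLaw, ae_withDensity_iff hcont.measurable.ennreal_ofReal]
  refine ae_of_all _ fun x hx => ?_
  obtain ⟨h0, h1⟩ := (hg.pos_iff q q.2 x).1 (ENNReal.ofReal_pos.1 (pos_iff_ne_zero.2 hx))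
  have h2 := (abs_le.1 (hδ q q.2)).2
  have h3 := hg.g0_lt q q.2
  have h4 := hg.lt_g1 q q.2
  exact abs_lt.2 ⟨by linarith, by linarith⟩

theorem IsDensity.measurable_apply (hd : IsDensity g μ h) (q : Quantity qbar) :
    Measurable (h q) :=
  hd.measurable.comp measurable_prodMk_left

theorem IsDensity.measurable_ofReal (hd : IsDensity g μ h) :
    Measurable fun p : Quantity qbar × ℝ => ENNReal.ofReal (h p.1 p.2) :=
  hd.measurable.ennreal_ofReal

theorem IsDensity.integrable (hd : IsDensity g μ h) (q : Quantity qbar) :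
    Integrable (h q) (μ : Measure ℝ) := by
  obtain ⟨f, -, hf, hhf⟩ := hd.bounded
  refine hf.mono' (hd.measurable_apply q).aestronglyMeasurable (ae_of_all _ fun s => ?_)
  rw [Real.norm_of_nonneg (hd.nonneg q s)]
  exact hhf q s

theorem IsDensity.lintegral_eq_one (hd : IsDensity g μ h) (hg : IsSignal qbar g g0 g1)
    (q : Quantity qbar) : ∫⁻ s, ENNReal.ofReal (h q s) ∂(μ : Measure ℝ) = 1 := by
  rw [← hg.signalLaw_univ q, hd.signalLaw_eq, withDensity_apply _ MeasurableSet.univ,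
    setLIntegral_univ]

theorem IsDensity.ae_abs_sub_lt (hd : IsDensity g μ h) (hg : IsSignal qbar g g0 g1) {δ : ℝ}
    (hδ : ∀ q ∈ Icc 0 qbar, |g1 q - g0 q| ≤ δ) (q : Quantity qbar) :
    ∀ᵐ s ∂(μ : Measure ℝ), 0 < h q s → |s - (q : ℝ)| < δ := by
  have := hg.ae_abs_sub_lt hδ q
  rw [hd.signalLaw_eq, ae_withDensity_iff (hd.measurable_apply q).ennreal_ofReal] at this
  filter_upwards [this] with s hs hpos
  exact hs (ENNReal.ofReal_pos.2 hpos).ne'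

theorem IsFollowerStrategic.map_fst {m : ProbabilityMeasure (ℝ × Quantity qbar)}
    (hm : IsFollowerStrategic μ m) :
    (m : Measure (ℝ × Quantity qbar)).map Prod.fst = (μ : Measure ℝ) := by
  obtain ⟨β, hβ, h⟩ := hm
  rw [h]
  exact Measure.fst_compProd _ _

/-- The distribution of the leader's quantity and the signal does not depend on the follower. -/
theorem map_playLaw (hd : IsDensity g μ h) {m : Profile qbar} (hm : IsStrategic μ m) :
    (playLaw h m).map (fun p => (p.1, p.2.1)) =
      ((m.1 : Measure (Quantity qbar)).prod (μ : Measure ℝ)).withDensity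
        fun p => ENNReal.ofReal (h p.1 p.2) := by
  have hT : Measurable fun p : Quantity qbar × ℝ × Quantity qbar => (p.1, p.2.1) := by fun_prop
  have hprod : (m.1 : Measure (Quantity qbar)).prod (μ : Measure ℝ) =
      ((m.1 : Measure (Quantity qbar)).prod (m.2 : Measure (ℝ × Quantity qbar))).map
        (fun p => (p.1, p.2.1)) := by
    change _ = Measure.map (Prod.map id Prod.fst) _
    rw [← Measure.map_prod_map _ _ measurable_id measurable_fst, Measure.map_id, hm.map_fst]
  ext A hA
  rw [Measure.map_apply hT hA, playLaw, withDensity_apply _ (hT hA), withDensity_apply _ hA, hprod,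
    setLIntegral_map hA hd.measurable_ofReal hT]

theorem isProbabilityMeasure_playLaw (hd : IsDensity g μ h) (hg : IsSignal qbar g g0 g1)
    {m : Profile qbar} (hm : IsStrategic μ m) : IsProbabilityMeasure (playLaw h m) := by
  refine ⟨?_⟩
  have hT : Measurable fun p : Quantity qbar × ℝ × Quantity qbar => (p.1, p.2.1) := by fun_prop
  rw [← preimage_univ (f := fun p : Quantity qbar × ℝ × Quantity qbar => (p.1, p.2.1)),
    ← Measure.map_apply hT MeasurableSet.univ, map_playLaw hd hm,
    withDensity_apply _ MeasurableSet.univ, setLIntegral_univ,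
    lintegral_prod _ hd.measurable_ofReal.aemeasurable]
  simp [hd.lintegral_eq_one hg]

/-- The right side does not involve the follower, so a deviation of the follower leaves the
probability of reaching `F` unchanged. -/
theorem playLaw_playsThrough (hd : IsDensity g μ h) {m : Profile qbar} (hm : IsStrategic μ m)
    {F : Set ℝ} (hF : MeasurableSet F) :
    playLaw h m (playsThrough qbar F) =
      ∫⁻ q, ∫⁻ s in F, ENNReal.ofReal (h q s) ∂(μ : Measure ℝ) ∂(m.1 : Measure (Quantity qbar)) := by
  have hT : Measurable fun p : Quantity qbar × ℝ × Quantity qbar => (p.1, p.2.1) := by fun_prop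
  have hFm : MeasurableSet ((univ : Set (Quantity qbar)) ×ˢ F) := MeasurableSet.univ.prod hF
  have : playsThrough qbar F =
      (fun p : Quantity qbar × ℝ × Quantity qbar => (p.1, p.2.1)) ⁻¹' (univ ×ˢ F) := by
    ext p; simp [playsThrough]
  rw [this, ← Measure.map_apply hT hFm, map_playLaw hd hm, withDensity_apply _ hFm,
    ← Measure.prod_restrict, Measure.restrict_univ,
    lintegral_prod _ hd.measurable_ofReal.aemeasurable]

theorem ae_playLaw_abs_sub_lt (hd : IsDensity g μ h) (hg : IsSignal qbar g g0 g1) {δ : ℝ}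
    (hδ : ∀ q ∈ Icc 0 qbar, |g1 q - g0 q| ≤ δ) {m : Profile qbar} (hm : IsStrategic μ m) :
    ∀ᵐ p ∂(playLaw h m), |p.2.1 - (p.1 : ℝ)| < δ := by
  have hT : Measurable fun p : Quantity qbar × ℝ × Quantity qbar => (p.1, p.2.1) := by fun_prop
  have hS : MeasurableSet {p : Quantity qbar × ℝ | |p.2 - (p.1 : ℝ)| < δ} :=
    measurableSet_lt (by fun_prop) measurable_const
  have hS' : MeasurableSet {p : Quantity qbar × ℝ | 0 < h p.1 p.2} :=
    measurableSet_lt measurable_const hd.measurable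
  have : ∀ᵐ p ∂((playLaw h m).map fun p : Quantity qbar × ℝ × Quantity qbar => (p.1, p.2.1)), |p.2 - (p.1 : ℝ)| < δ := by
    rw [map_playLaw hd hm, ae_withDensity_iff hd.measurable_ofReal]
    have h1 : ∀ᵐ p ∂((m.1 : Measure (Quantity qbar)).prod (μ : Measure ℝ)),
        0 < h p.1 p.2 → |p.2 - (p.1 : ℝ)| < δ := by
      rw [Measure.ae_prod_iff_ae_ae (hS'.imp hS)]
      exact ae_of_all _ (hd.ae_abs_sub_lt hg hδ)
    filter_upwards [h1] with p hp hne
    exact hp (ENNReal.ofReal_pos.1 (pos_iff_ne_zero.2 hne))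
  exact ae_of_ae_map hT.aemeasurable this

theorem integrable_density_mul (hd : IsDensity g μ h)
    {m : ProbabilityMeasure (ℝ × Quantity qbar)} (hm : IsFollowerStrategic μ m)
    (q : Quantity qbar) {k : ℝ × Quantity qbar → ℝ} (hk : Measurable k) {C : ℝ}
    (hC : ∀ p, |k p| ≤ C) :
    Integrable (fun p => h q p.1 * k p) (m : Measure (ℝ × Quantity qbar)) := by
  have h1 : Integrable (fun p : ℝ × Quantity qbar => h q p.1)
      (m : Measure (ℝ × Quantity qbar)) := by
    have := hd.integrable q
    rw [← hm.map_fst] at this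
    exact this.comp_measurable measurable_fst
  exact h1.mul_bdd hk.aestronglyMeasurable (ae_of_all _ hC)

theorem integral_playLaw (hd : IsDensity g μ h) {m : Profile qbar} (hm : IsStrategic μ m)
    {k : Quantity qbar × ℝ × Quantity qbar → ℝ} (hk : Measurable k) {C : ℝ}
    (hC : ∀ p, |k p| ≤ C) :
    ∫ p, k p ∂(playLaw h m) = ∫ q, ∫ p, h q p.1 * k (q, p)
      ∂(m.2 : Measure (ℝ × Quantity qbar)) ∂(m.1 : Measure (Quantity qbar)) := by
  have hh : Measurable fun p : Quantity qbar × ℝ × Quantity qbar => h p.1 p.2.1 :=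
    hd.measurable.comp (f := fun p : Quantity qbar × ℝ × Quantity qbar => (p.1, p.2.1))
      (by fun_prop)
  rw [playLaw, integral_withDensity_eq_integral_toReal_smul hh.ennreal_ofReal (by simp)]
  simp only [ENNReal.toReal_ofReal (hd.nonneg _ _), smul_eq_mul]
  refine integral_prod (fun p : Quantity qbar × ℝ × Quantity qbar => h p.1 p.2.1 * k p) ?_
  -- The bound `f` is uniform in the leader's quantity, which gives integrability on the product and
  -- so Fubini.
  obtain ⟨f, -, hf, hhf⟩ := hd.bounded
  have h1 : Integrable (fun p : Quantity qbar × ℝ × Quantity qbar => f p.2.1)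
      ((m.1 : Measure (Quantity qbar)).prod (m.2 : Measure (ℝ × Quantity qbar))) := by
    have h2 : Integrable (fun p : ℝ × Quantity qbar => f p.1)
        (m.2 : Measure (ℝ × Quantity qbar)) := by
      rw [← hm.map_fst] at hf
      exact hf.comp_measurable measurable_fst
    exact h2.comp_snd _
  refine (h1.mono' hh.aestronglyMeasurable (ae_of_all _ fun p => ?_)).mul_bdd
    hk.aestronglyMeasurable (ae_of_all _ hC)
  rw [Real.norm_of_nonneg (hd.nonneg _ _)]
  exact hhf _ _

theorem integral_playLaw_compProd (hd : IsDensity g μ h) {m : Profile qbar}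
    {β : Kernel ℝ (Quantity qbar)} [IsMarkovKernel β]
    (hβ : (m.2 : Measure (ℝ × Quantity qbar)) = (μ : Measure ℝ) ⊗ₘ β)
    {k : ℝ × Quantity qbar → ℝ} (hk : Measurable k) {C : ℝ} (hC : ∀ p, |k p| ≤ C) :
    ∫ p, k p.2 ∂(playLaw h m) = ∫ q, ∫ s, h q s * ∫ x, k (s, x) ∂(β s)
      ∂(μ : Measure ℝ) ∂(m.1 : Measure (Quantity qbar)) := by
  have hm : IsFollowerStrategic μ m.2 := ⟨β, inferInstance, hβ⟩
  rw [integral_playLaw (k := fun p => k p.2) hd hm (hk.comp measurable_snd) (fun p => hC p.2)]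
  refine integral_congr_ae (ae_of_all _ fun q => ?_)
  have hint := integrable_density_mul hd hm q hk hC
  dsimp only
  rw [hβ] at hint ⊢
  rw [Measure.integral_compProd hint]
  simp_rw [integral_const_mul]

end Signal

end NoisyDuopoly

/-! ### Two convergence principles for weak limits -/

/-- Weak limits of measures with a fixed first marginal are also limits in the sense of test
functions that are merely integrable in the first variable. -/
theorem tendsto_integral_mul_of_map_fst {X ι : Type*} [TopologicalSpace X]
    [SecondCountableTopology X] [MeasurableSpace X] [BorelSpace X] {l : Filter ι}
    {ν : Measure ℝ} [IsFiniteMeasure ν]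
    {u : ι → ProbabilityMeasure (ℝ × X)} {m : ProbabilityMeasure (ℝ × X)}
    (hu : ∀ i, (u i : Measure (ℝ × X)).map Prod.fst = ν)
    (hm : (m : Measure (ℝ × X)).map Prod.fst = ν) (hlim : Tendsto u l (𝓝 m))
    {a : ℝ → ℝ} (ha : Integrable a ν) (k : BoundedContinuousFunction X ℝ) :
    Tendsto (fun i => ∫ p, a p.1 * k p.2 ∂(u i : Measure (ℝ × X))) l
      (𝓝 (∫ p, a p.1 * k p.2 ∂(m : Measure (ℝ × X)))) := by
  rw [Metric.tendsto_nhds]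
  intro ε hε
  have hC : 0 < ‖k‖ + 1 := by positivity
  -- Replacing `a` by a bounded continuous φ close in L¹(ν) costs the same small error under every
  -- measure with first marginal ν.
  obtain ⟨φ, hφ, hφi⟩ := ha.exists_boundedContinuous_integral_sub_le
    (show 0 < ε / (3 * (‖k‖ + 1)) by positivity)
  have happrox : ∀ n : ProbabilityMeasure (ℝ × X), (n : Measure (ℝ × X)).map Prod.fst = ν →
      |∫ p, a p.1 * k p.2 ∂(n : Measure (ℝ × X)) - ∫ p, φ p.1 * k p.2 ∂(n : Measure (ℝ × X))|
        ≤ ε / 3 := by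
    intro n hn
    have hk : AEStronglyMeasurable (fun p : ℝ × X => k p.2) (n : Measure (ℝ × X)) :=
      (k.continuous.measurable.comp measurable_snd).aestronglyMeasurable
    have hkb : ∀ᵐ p ∂(n : Measure (ℝ × X)), ‖k p.2‖ ≤ ‖k‖ := ae_of_all _ fun p => k.norm_coe_le_norm _
    have hcomp : ∀ {b : ℝ → ℝ}, Integrable b ν →
        Integrable (fun p : ℝ × X => b p.1) (n : Measure (ℝ × X)) := by
      intro b hb
      rw [← hn] at hb
      exact hb.comp_measurable measurable_fst
    have hnorm : Integrable (fun s => ‖a s - φ s‖) ν := (ha.sub hφi).norm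
    have hint : ∫ p, ‖a p.1 - φ p.1‖ ∂(n : Measure (ℝ × X)) = ∫ s, ‖a s - φ s‖ ∂ν := by
      have hnm := hnorm.aestronglyMeasurable
      rw [← hn] at hnm ⊢
      exact (integral_map measurable_fst.aemeasurable hnm).symm
    rw [← integral_sub ((hcomp ha).mul_bdd hk hkb) ((hcomp hφi).mul_bdd hk hkb), ← Real.norm_eq_abs]
    calc _ ≤ ∫ p, ‖a p.1 - φ p.1‖ * (‖k‖ + 1) ∂(n : Measure (ℝ × X)) := by
          refine norm_integral_le_of_norm_le ((hcomp hnorm).mul_const _) (ae_of_all _ fun p => ?_)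
          rw [← sub_mul, norm_mul]
          exact mul_le_mul_of_nonneg_left ((k.norm_coe_le_norm _).trans (by linarith))
            (norm_nonneg _)
      _ ≤ ε / (3 * (‖k‖ + 1)) * (‖k‖ + 1) := by
          rw [integral_mul_const, hint]
          exact mul_le_mul_of_nonneg_right hφ hC.le
      _ = ε / 3 := by field_simp
  have hcont := (ProbabilityMeasure.tendsto_iff_forall_integral_tendsto.1 hlim)
    (φ.compContinuous ⟨Prod.fst, continuous_fst⟩ * k.compContinuous ⟨Prod.snd, continuous_snd⟩)
  filter_upwards [(Metric.tendsto_nhds.1 hcont) (ε / 3) (by positivity)] with i hi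
  simp only [BoundedContinuousFunction.coe_mul, Pi.mul_apply,
    BoundedContinuousFunction.compContinuous_apply, ContinuousMap.coe_mk, Real.dist_eq] at hi ⊢
  have h1 := abs_le.1 (happrox (u i) (hu i))
  have h2 := abs_le.1 (happrox m hm)
  have h3 := abs_lt.1 hi
  exact abs_lt.2 ⟨by linarith, by linarith⟩

/-- Joint convergence of integrands and measures, for an equicontinuous sequence of integrands. -/
theorem tendsto_integral_of_equicontinuous {X ι : Type*} [TopologicalSpace X] [CompactSpace X]
    [MeasurableSpace X] [BorelSpace X] {l : Filter ι} [l.NeBot] {u : ι → ProbabilityMeasure X}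
    {m : ProbabilityMeasure X} (hu : Tendsto u l (𝓝 m)) {Φ : ι → X → ℝ} {Ψ : X → ℝ}
    (hΦ : Equicontinuous Φ) (hlim : ∀ x, Tendsto (fun i => Φ i x) l (𝓝 (Ψ x))) :
    Tendsto (fun i => ∫ x, Φ i x ∂(u i : Measure X)) l (𝓝 (∫ x, Ψ x ∂(m : Measure X))) := by
  -- On a compact space, equicontinuity upgrades pointwise to uniform convergence.
  have hunif : TendstoUniformly Φ Ψ l :=
    UniformFun.tendsto_iff_tendstoUniformly.1
      ((hΦ.tendsto_uniformFun_iff_pi l Ψ).2 (tendsto_pi_nhds.2 hlim))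
  have hΨ : Continuous Ψ := hunif.continuous (Eventually.of_forall hΦ.continuous).frequently
  have hint : ∀ {f : X → ℝ} (n : ProbabilityMeasure X), Continuous f →
      Integrable f (n : Measure X) := fun n hf =>
    BoundedContinuousFunction.integrable _ (BoundedContinuousFunction.mkOfCompact ⟨_, hf⟩)
  have hlimΨ := ProbabilityMeasure.tendsto_iff_forall_integral_tendsto.1 hu
    (BoundedContinuousFunction.mkOfCompact ⟨Ψ, hΨ⟩)
  rw [Metric.tendsto_nhds] at hlimΨ ⊢
  intro ε hε
  filter_upwards [hlimΨ (ε / 2) (by positivity),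
    Metric.tendstoUniformly_iff.1 hunif (ε / 2) (by positivity)] with i h1 h2
  simp only [BoundedContinuousFunction.mkOfCompact_apply, ContinuousMap.coe_mk] at h1
  have h3 : dist (∫ x, Φ i x ∂(u i : Measure X)) (∫ x, Ψ x ∂(u i : Measure X)) ≤ ε / 2 := by
    rw [dist_eq_norm, ← integral_sub (hint _ (hΦ.continuous i)) (hint _ hΨ)]
    refine (norm_integral_le_of_norm_le_const (C := ε / 2) (ae_of_all _ fun x => ?_)).trans
      (by simp)
    rw [← dist_eq_norm, dist_comm]
    exact (h2 x).le
  linarith [dist_triangle (∫ x, Φ i x ∂(u i : Measure X)) (∫ x, Ψ x ∂(u i : Measure X))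
    (∫ x, Ψ x ∂(m : Measure X))]

namespace NoisyDuopoly

/-! ### Continuity of the leader's payoff along strategic profiles -/

variable {qbar : ℝ} {π : ℝ → ℝ → ℝ} {g : ℝ → ℝ → ℝ} {μ : ProbabilityMeasure ℝ}
  {h : Quantity qbar → ℝ → ℝ}

theorem exists_payoff_bound
    (hπ : Continuous fun p : Quantity qbar × Quantity qbar => π p.1 p.2) :
    ∃ C : ℝ, ∀ x y : Quantity qbar, |π x y| ≤ C := by
  obtain ⟨C, hC⟩ := isCompact_univ.exists_bound_of_continuousOn hπ.continuousOn
  exact ⟨C, fun x y => hC (x, y) (mem_univ _)⟩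

theorem IsDensity.continuous_integral_abs_sub (hd : IsDensity g μ h) (q : Quantity qbar) :
    Continuous fun q' => ∫ s, |h q s - h q' s| ∂(μ : Measure ℝ) := by
  obtain ⟨f, -, hf, hhf⟩ := hd.bounded
  refine continuous_of_dominated (bound := fun s => f s + f s) (fun q' => ?_)
    (fun q' => ae_of_all _ fun s => ?_) (hf.add hf) (ae_of_all _ fun s => ?_)
  · exact (((hd.integrable q).sub (hd.integrable q')).abs).aestronglyMeasurable
  · rw [Real.norm_eq_abs, abs_abs]
    refine (abs_sub _ _).trans ?_
    rw [abs_of_nonneg (hd.nonneg q s), abs_of_nonneg (hd.nonneg q' s)]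
    exact add_le_add (hhf q s) (hhf q' s)
  · exact (continuous_const.sub (hd.continuous s)).abs

/-- All follower strategies share the signal marginal `μ`, so one modulus serves them all: the L¹(μ)
variation of the density plus the sup-norm variation of the profit. -/
theorem equicontinuous_integral_density_mul (hd : IsDensity g μ h)
    (hπ : Continuous fun p : Quantity qbar × Quantity qbar => π p.1 p.2) :
    Equicontinuous fun (m : {m : ProbabilityMeasure (ℝ × Quantity qbar) //
      IsFollowerStrategic μ m}) (q : Quantity qbar) =>
        ∫ p, h q p.1 * π q p.2 ∂(m.1 : Measure (ℝ × Quantity qbar)) := by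
  obtain ⟨C, hC⟩ := exists_payoff_bound hπ
  let P : C(Quantity qbar, C(Quantity qbar, ℝ)) := ContinuousMap.curry ⟨_, hπ⟩
  intro q
  refine Metric.equicontinuousAt_of_continuity_modulus
    (fun q' => (∫ s, |h q s - h q' s| ∂(μ : Measure ℝ)) * C +
      (∫ s, h q s ∂(μ : Measure ℝ)) * dist (P q) (P q')) ?_ _ (Eventually.of_forall ?_)
  · have : Continuous fun q' => (∫ s, |h q s - h q' s| ∂(μ : Measure ℝ)) * C +
        (∫ s, h q s ∂(μ : Measure ℝ)) * dist (P q) (P q') :=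
      ((hd.continuous_integral_abs_sub q).mul continuous_const).add
        (continuous_const.mul (continuous_const.dist P.continuous))
    simpa using this.tendsto q
  · rintro q' ⟨m, hm⟩
    have hmeas : ∀ q : Quantity qbar, Measurable fun p : ℝ × Quantity qbar => π q p.2 := fun q =>
      (hπ.comp (f := fun p : ℝ × Quantity qbar => (q, p.2)) (by fun_prop)).measurable
    have hcomp : ∀ {b : ℝ → ℝ}, Integrable b (μ : Measure ℝ) →
        Integrable (fun p : ℝ × Quantity qbar => b p.1) (m : Measure (ℝ × Quantity qbar)) ∧
        ∫ p, b p.1 ∂(m : Measure (ℝ × Quantity qbar)) = ∫ s, b s ∂(μ : Measure ℝ) := by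
      intro b hb
      rw [← hm.map_fst] at hb ⊢
      exact ⟨hb.comp_measurable measurable_fst,
        (integral_map measurable_fst.aemeasurable hb.aestronglyMeasurable).symm⟩
    obtain ⟨h1, h1'⟩ := hcomp ((hd.integrable q).sub (hd.integrable q')).abs
    obtain ⟨h2, h2'⟩ := hcomp (hd.integrable q)
    simp only [Pi.sub_apply] at h1 h1'
    rw [dist_eq_norm, ← integral_sub (integrable_density_mul hd hm q (hmeas q) fun p => hC _ _)
      (integrable_density_mul hd hm q' (hmeas q') fun p => hC _ _), ← h1', ← h2',
      ← integral_mul_const, ← integral_mul_const,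
      ← integral_add (h1.mul_const _) (h2.mul_const _)]
    refine norm_integral_le_of_norm_le ((h1.mul_const _).add (h2.mul_const _))
      (ae_of_all _ fun p => ?_)
    have e : h q p.1 * π q p.2 - h q' p.1 * π q' p.2 =
      (h q p.1 - h q' p.1) * π q' p.2 + h q p.1 * (π q p.2 - π q' p.2) := by ring
    rw [e]
    refine (norm_add_le _ _).trans (add_le_add ?_ ?_)
    · rw [norm_mul]
      exact mul_le_mul_of_nonneg_left (hC _ _) (norm_nonneg _)
    · rw [norm_mul, Real.norm_of_nonneg (hd.nonneg _ _)]
      exact mul_le_mul_of_nonneg_left (ContinuousMap.dist_apply_le_dist (f := P q) (g := P q') p.2)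
        (hd.nonneg _ _)

theorem leaderPayoff_eq (hd : IsDensity g μ h)
    (hπ : Continuous fun p : Quantity qbar × Quantity qbar => π p.1 p.2) {m : Profile qbar}
    (hm : IsStrategic μ m) :
    leaderPayoff π h m = ∫ q, ∫ p, h q p.1 * π q p.2
      ∂(m.2 : Measure (ℝ × Quantity qbar)) ∂(m.1 : Measure (Quantity qbar)) := by
  obtain ⟨C, hC⟩ := exists_payoff_bound hπ
  exact integral_playLaw (k := fun p => π p.1 p.2.2) hd hm
    (hπ.comp (f := fun p : Quantity qbar × ℝ × Quantity qbar => (p.1, p.2.2))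
      (by fun_prop)).measurable fun p => hC _ _

/-- For a fixed quantity the payoff converges because the signal marginal is fixed; equicontinuity
in the quantity then allows the leader's distribution to vary as well. -/
theorem tendsto_leaderPayoff (hd : IsDensity g μ h)
    (hπ : Continuous fun p : Quantity qbar × Quantity qbar => π p.1 p.2)
    {u : ℕ → Profile qbar} {m : Profile qbar} (hu : ∀ n, IsStrategic μ (u n))
    (hm : IsStrategic μ m) (hlim : Tendsto u atTop (𝓝 m)) :
    Tendsto (fun n => leaderPayoff π h (u n)) atTop (𝓝 (leaderPayoff π h m)) := by
  simp only [leaderPayoff_eq hd hπ hm, fun n => leaderPayoff_eq hd hπ (hu n)]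
  refine tendsto_integral_of_equicontinuous ((continuous_fst.tendsto m).comp hlim)
    ((equicontinuous_integral_density_mul hd hπ).comp fun n => ⟨(u n).2, hu n⟩) fun q => ?_
  have hc : Continuous fun x : Quantity qbar => π q x :=
    hπ.comp (f := fun x : Quantity qbar => (q, x)) (by fun_prop)
  exact tendsto_integral_mul_of_map_fst (fun n => (hu n).map_fst) hm.map_fst
    ((continuous_snd.tendsto m).comp hlim) (hd.integrable q)
    (BoundedContinuousFunction.mkOfCompact ⟨_, hc⟩)

end NoisyDuopoly

namespace NoisyDuopoly

/-! ### The follower's regret and the leader's deviation -/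

variable {qbar : ℝ} {π : ℝ → ℝ → ℝ} {g : ℝ → ℝ → ℝ} {g0 g1 : ℝ → ℝ} {μ : ProbabilityMeasure ℝ}
  {h : Quantity qbar → ℝ → ℝ}

/-- The leader reaches `F` by producing `q` for sure; `m` only supplies some strategy of the
follower. -/
theorem isRelevant_of_density_pos (hd : IsDensity g μ h) {m : Profile qbar}
    (hm : IsStrategic μ m) {F : Set ℝ} (hF : MeasurableSet F) {q : Quantity qbar}
    (hpos : ∀ s ∈ F, 0 < h q s) (hμF : (μ : Measure ℝ) F ≠ 0) : IsRelevant μ h F := by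
  refine ⟨hF, (diracProba q, m.2), hm, ?_⟩
  rw [Reached, playLaw_playsThrough hd (m := (diracProba q, m.2)) hm hF]
  simp only [diracProba, ProbabilityMeasure.coe_mk, lintegral_dirac]
  rw [setLIntegral_pos_iff (hd.measurable_apply q).ennreal_ofReal]
  have : Function.support (fun s => ENNReal.ofReal (h q s)) ∩ F = F :=
    inter_eq_right.2 fun s hs => (ENNReal.ofReal_pos.2 (hpos s hs)).ne'
  rw [this]
  exact pos_iff_ne_zero.2 hμF

/-- At almost every signal that is possible when the leader produces `q`, the follower's strategy
is almost a best response to `q`. -/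
theorem ae_integral_regret_neg (hd : IsDensity g μ h) (hg : IsSignal qbar g g0 g1)
    (hπ : Continuous fun p : Quantity qbar × Quantity qbar => π p.1 p.2) {δ ω η : ℝ}
    (hδ : ∀ q ∈ Icc 0 qbar, |g1 q - g0 q| ≤ δ) {q r : Quantity qbar}
    (hω : ∀ x q' : Quantity qbar, |(q' : ℝ) - q| < 2 * δ → |π x q' - π x q| ≤ ω)
    {m : Profile qbar} {β : Kernel ℝ (Quantity qbar)} [IsMarkovKernel β]
    (hβ : (m.2 : Measure (ℝ × Quantity qbar)) = (μ : Measure ℝ) ⊗ₘ β)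
    (hreach : ∀ F, IsRelevant (qbar := qbar) μ h F → Reached h m F)
    (hopt : ∀ F, IsRelevant (qbar := qbar) μ h F → FollowerOptimalAt π μ h m F η) :
    ∀ᵐ s ∂(μ : Measure ℝ), 0 < h q s → ∫ x, (π r q - π x q - (2 * ω + η)) ∂(β s) < 0 := by
  obtain ⟨C, hC⟩ := exists_payoff_bound hπ
  have hm : IsStrategic μ m := ⟨β, inferInstance, hβ⟩
  have hcont : Continuous fun x : Quantity qbar => π x q :=
    hπ.comp (f := fun x : Quantity qbar => (x, q)) (by fun_prop)
  have hkc : Continuous fun x : Quantity qbar => π r q - π x q - (2 * ω + η) :=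
    (continuous_const.sub hcont).sub continuous_const
  have hdm : Measurable fun s => ∫ x, (π r q - π x q - (2 * ω + η)) ∂(β s) :=
    hkc.stronglyMeasurable.integral_kernel.measurable
  -- The bad signals. Requiring closeness to `q` removes only a null set and makes it available at
  -- every point of `F`.
  let F : Set ℝ := {s | 0 < h q s} ∩ {s | |s - (q : ℝ)| < δ} ∩
    {s | 0 ≤ ∫ x, (π r q - π x q - (2 * ω + η)) ∂(β s)}
  have hF : MeasurableSet F :=
    ((measurableSet_lt measurable_const (hd.measurable_apply q)).inter
      (measurableSet_lt (by fun_prop) measurable_const)).inter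
      (measurableSet_le measurable_const hdm)
  suffices hnull : (μ : Measure ℝ) F = 0 by
    filter_upwards [measure_eq_zero_iff_ae_notMem.1 hnull, hd.ae_abs_sub_lt hg hδ q]
      with s hs hs' hpos
    by_contra! hge
    exact hs ⟨⟨hpos, hs' hpos⟩, hge⟩
  by_contra hμF
  have hrel : IsRelevant μ h F := isRelevant_of_density_pos hd hm hF (fun s hs => hs.1.1) hμF
  have hZ : playLaw h m (playsThrough qbar F) ≠ 0 := (hreach F hrel).ne'
  -- The follower's deviation ignores the signal and always produces `r`.
  let m₂ : ProbabilityMeasure (ℝ × Quantity qbar) :=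
    ⟨(μ : Measure ℝ) ⊗ₘ Kernel.const ℝ (Measure.dirac r), inferInstance⟩
  have hm₂ : IsFollowerStrategic μ m₂ := ⟨_, inferInstance, rfl⟩
  have hm' : IsStrategic μ (m.1, m₂) := hm₂
  have hZ' : playLaw h (m.1, m₂) (playsThrough qbar F) ≠ 0 := by
    rwa [playLaw_playsThrough hd hm' hF, ← playLaw_playsThrough hd hm hF]
  have hthrough : MeasurableSet (playsThrough qbar F) :=
    hF.preimage (f := fun p : Quantity qbar × ℝ × Quantity qbar => p.2.1) (by fun_prop)
  have hown : Continuous fun p : Quantity qbar × ℝ × Quantity qbar => π p.2.2 p.1 :=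
    hπ.comp (f := fun p : Quantity qbar × ℝ × Quantity qbar => (p.2.2, p.1)) (by fun_prop)
  have hownq : Continuous fun p : Quantity qbar × ℝ × Quantity qbar => π p.2.2 q :=
    hcont.comp (f := fun p : Quantity qbar × ℝ × Quantity qbar => p.2.2) (by fun_prop)
  -- Given `F`, the signal is within δ of both `q` and the true quantity, so evaluating the
  -- follower's profit at `q` instead costs at most ω.
  have hclose : ∀ {n : Profile qbar}, IsStrategic μ n →
      ∀ᵐ p ∂(cond (playLaw h n) (playsThrough qbar F)), |π p.2.2 p.1 - π p.2.2 q| ≤ ω := by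
    intro n hn
    filter_upwards [cond_absolutelyContinuous.ae_le (ae_playLaw_abs_sub_lt hd hg hδ hn),
      ae_cond_mem hthrough] with p hp hpF
    have h1 : |p.2.1 - (q : ℝ)| < δ := hpF.1.2
    refine hω _ _ ?_
    rw [abs_lt] at h1 hp ⊢
    constructor <;> linarith
  have hint : ∀ {ν : Measure (Quantity qbar × ℝ × Quantity qbar)} [IsFiniteMeasure ν],
      Integrable (fun p => π p.2.2 p.1) ν ∧ Integrable (fun p => π p.2.2 q) ν := by
    intro ν _
    exact ⟨Integrable.of_bound hown.measurable.aestronglyMeasurable C (ae_of_all _ fun p => hC _ _),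
      Integrable.of_bound hownq.measurable.aestronglyMeasurable C (ae_of_all _ fun p => hC _ _)⟩
  have := isProbabilityMeasure_playLaw hd hg hm
  have := isProbabilityMeasure_playLaw hd hg hm'
  have := cond_isProbabilityMeasure hZ
  have := cond_isProbabilityMeasure hZ'
  have hdev : π r q - ω ≤ followerPayoffGiven π h (m.1, m₂) F := by
    have hr : ∀ᵐ p ∂(cond (playLaw h (m.1, m₂)) (playsThrough qbar F)), p.2.2 = r := by
      refine cond_absolutelyContinuous.ae_le ((withDensity_absolutelyContinuous _ _).ae_le ?_)
      refine Measure.quasiMeasurePreserving_snd.ae (p := fun p : ℝ × Quantity qbar => p.2 = r) ?_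
      refine Measure.ae_compProd_of_ae_ae
        (measurableSet_eq_fun measurable_snd measurable_const) (ae_of_all _ fun s => ?_)
      simp [ae_dirac_eq]
    calc π r q - ω = ∫ _, (π r q - ω) ∂(cond (playLaw h (m.1, m₂)) (playsThrough qbar F)) := by
          simp
      _ ≤ _ := by
          refine integral_mono_ae (integrable_const _) hint.1 ?_
          filter_upwards [hr, hclose hm'] with p hp hp'
          rw [hp] at hp' ⊢
          linarith [(abs_le.1 hp').1]
  have hcur : followerPayoffGiven π h m F ≤
      ∫ p, π p.2.2 q ∂(cond (playLaw h m) (playsThrough qbar F)) + ω := by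
    calc _ ≤ ∫ p, (π p.2.2 q + ω) ∂(cond (playLaw h m) (playsThrough qbar F)) := by
          refine integral_mono_ae hint.1 (hint.2.add (integrable_const _)) ?_
          filter_upwards [hclose hm] with p hp
          linarith [(abs_le.1 hp).2]
      _ = _ := by
          rw [integral_add hint.2 (integrable_const _)]
          simp
  have hlt := hopt F hrel m₂ hm₂
  -- One ω for each of the two payoffs compared, and η for the near-optimality.
  have hcond : ∫ p, (π r q - π p.2.2 q - (2 * ω + η))
      ∂(cond (playLaw h m) (playsThrough qbar F)) < 0 := by
    have hreg : Integrable (fun p : Quantity qbar × ℝ × Quantity qbar => π r q - π p.2.2 q)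
        (ProbabilityTheory.cond (playLaw h m) (playsThrough qbar F)) :=
      (integrable_const _).sub hint.2
    rw [integral_sub hreg (integrable_const _), integral_sub (integrable_const _) hint.2]
    simp only [integral_const, probReal_univ, one_smul]
    linarith
  -- Up to a nonnegative factor, this is an integral over `F` of the kernel averages, which are
  -- nonnegative there by the choice of `F`.
  refine hcond.not_ge ?_
  rw [ProbabilityTheory.cond, integral_smul_measure]
  refine smul_nonneg ENNReal.toReal_nonneg ?_
  have hk : Measurable fun p : ℝ × Quantity qbar =>
      F.indicator (fun _ => π r q - π p.2 q - (2 * ω + η)) p.1 := by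
    have : (fun p : ℝ × Quantity qbar =>
        F.indicator (fun _ => π r q - π p.2 q - (2 * ω + η)) p.1) =
        (Prod.fst ⁻¹' F).indicator fun p : ℝ × Quantity qbar => π r q - π p.2 q - (2 * ω + η) := by
      ext p; simp [indicator]
    rw [this]
    exact (hkc.measurable.comp measurable_snd).indicator (measurable_fst hF)
  have hkC : ∀ p : ℝ × Quantity qbar,
      |F.indicator (fun _ => π r q - π p.2 q - (2 * ω + η)) p.1| ≤ 2 * C + |2 * ω + η| := by
    intro p
    refine (norm_indicator_le_norm_self (fun _ => π r q - π p.2 q - (2 * ω + η)) p.1).trans ?_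
    rw [Real.norm_eq_abs]
    linarith [abs_sub (π r q - π p.2 q) (2 * ω + η), abs_sub (π r q) (π p.2 q), hC r q, hC p.2 q]
  have hrw : ∫ p in playsThrough qbar F, (π r q - π p.2.2 q - (2 * ω + η)) ∂(playLaw h m) =
      ∫ p, F.indicator (fun _ => π r q - π p.2.2 q - (2 * ω + η)) p.2.1 ∂(playLaw h m) := by
    rw [← integral_indicator hthrough]
    refine integral_congr_ae (ae_of_all _ fun p => ?_)
    by_cases hp : p.2.1 ∈ F <;> simp [indicator, playsThrough, hp]
  rw [hrw, integral_playLaw_compProd hd hβ hk hkC]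
  refine integral_nonneg fun q' => integral_nonneg fun s => mul_nonneg (hd.nonneg _ _) ?_
  by_cases hs : s ∈ F
  · simpa [hs] using hs.2
  · simp [hs]

/-- A lower bound for what the leader obtains from the quantity `q`. -/
theorem le_leaderPayoff_dirac (hd : IsDensity g μ h) (hg : IsSignal qbar g g0 g1)
    (hπ : Continuous fun p : Quantity qbar × Quantity qbar => π p.1 p.2)
    {m₂ : ProbabilityMeasure (ℝ × Quantity qbar)} {β : Kernel ℝ (Quantity qbar)}
    [IsMarkovKernel β] (hβ : (m₂ : Measure (ℝ × Quantity qbar)) = (μ : Measure ℝ) ⊗ₘ β)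
    {q : Quantity qbar} {c : ℝ}
    (hc : ∀ᵐ s ∂(μ : Measure ℝ), 0 < h q s → c ≤ ∫ x, π q x ∂(β s)) :
    c ≤ leaderPayoff π h (diracProba q, m₂) := by
  obtain ⟨C, hC⟩ := exists_payoff_bound hπ
  have hm : IsFollowerStrategic μ m₂ := ⟨β, inferInstance, hβ⟩
  have hcont : Continuous fun x : Quantity qbar => π q x :=
    hπ.comp (f := fun x : Quantity qbar => (q, x)) (by fun_prop)
  have hint := integrable_density_mul hd hm q (k := fun p => π q p.2)
    (hcont.measurable.comp measurable_snd) fun p => hC _ _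
  rw [leaderPayoff_eq hd hπ (m := (diracProba q, m₂)) hm]
  simp only [diracProba, ProbabilityMeasure.coe_mk, integral_dirac]
  have hone : ∫ s, h q s ∂(μ : Measure ℝ) = 1 := by
    rw [integral_eq_lintegral_of_nonneg_ae (ae_of_all _ (hd.nonneg q))
      (hd.measurable_apply q).aestronglyMeasurable, hd.lintegral_eq_one hg, ENNReal.toReal_one]
  rw [hβ] at hint ⊢
  rw [Measure.integral_compProd hint]
  simp_rw [integral_const_mul]
  calc c = ∫ s, h q s * c ∂(μ : Measure ℝ) := by rw [integral_mul_const, hone, one_mul]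
    _ ≤ _ := by
      refine integral_mono_ae ((hd.integrable q).mul_const _)
        ((hd.integrable q).mul_bdd (c := C)
          hcont.stronglyMeasurable.integral_kernel.aestronglyMeasurable (ae_of_all _ fun s => ?_)) ?_
      · refine (norm_integral_le_of_norm_le_const (C := C) (ae_of_all _ fun x => hC _ _)).trans ?_
        simp
      · filter_upwards [hc] with s hs
        rcases (hd.nonneg q s).eq_or_lt with h0 | h0
        · simp [← h0]
        · exact mul_le_mul_of_nonneg_left (hs h0) h0.le

/-- Uniform continuity on the compact square makes δ independent of the signal structure. -/
theorem exists_modulus (hπ : Continuous fun p : Quantity qbar × Quantity qbar => π p.1 p.2)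
    {ω : ℝ} (hω : 0 < ω) :
    ∃ δ > 0, ∀ q x q' : Quantity qbar, |(q' : ℝ) - q| < 2 * δ → |π x q' - π x q| ≤ ω := by
  obtain ⟨ρ, hρ, H⟩ := Metric.uniformContinuous_iff.1
    (CompactSpace.uniformContinuous_of_continuous hπ) ω hω
  refine ⟨ρ / 2, by positivity, fun q x q' hq => ?_⟩
  have hdist : dist (x, q') (x, q) < ρ := by
    rw [Prod.dist_eq, dist_self, max_eq_right dist_nonneg, Subtype.dist_eq, Real.dist_eq]
    linarith
  exact (H hdist).le

end NoisyDuopoly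

/-! ### The lower bound on the leader's payoff -/

theorem mainTheorem3 (qbar : ℝ) (π : ℝ → ℝ → ℝ) (hπ : NoisyDuopoly.IsProfit qbar π)
    (ε : ℝ) (hε : 0 < ε) :
    ∃ δ : ℝ, 0 < δ ∧
      ∀ (g : ℝ → ℝ → ℝ) (g0 g1 : ℝ → ℝ), NoisyDuopoly.IsSignal qbar g g0 g1 →
        (∀ q ∈ Set.Icc 0 qbar, |g1 q - g0 q| ≤ δ) →
        ∀ (μ : MeasureTheory.ProbabilityMeasure ℝ) (h : NoisyDuopoly.Quantity qbar → ℝ → ℝ),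
          NoisyDuopoly.IsDensity g μ h →
          ∀ m : NoisyDuopoly.Profile qbar, NoisyDuopoly.IsSequentialEquilibrium π μ h m →
            ∀ (R : ℝ → ℝ) (ql : ℝ), NoisyDuopoly.IsReaction qbar π R →
              NoisyDuopoly.IsLeaderQuantity qbar π R ql →
              π ql (R ql) - ε ≤ NoisyDuopoly.leaderPayoff π h m := by
  open NoisyDuopoly in
  -- δ must precede `R` and `ql`. It is built from one such pair, if there is any; every other pair
  -- gives the leader no more, since best replies are unique.
  by_cases hex : ∃ (R : ℝ → ℝ) (ql : ℝ), IsReaction qbar π R ∧ IsLeaderQuantity qbar π R ql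
  swap
  · exact ⟨1, one_pos, fun _ _ _ _ _ _ _ _ _ _ R ql hR hql => (hex ⟨R, ql, hR, hql⟩).elim⟩
  obtain ⟨R, ql, hR, hql⟩ := hex
  have hc := hπ.continuous
  let q : Quantity qbar := ⟨ql, hql.1⟩
  let r : Quantity qbar := ⟨R ql, (hR ql hql.1).1⟩
  obtain ⟨K, hK, htrade⟩ :=
    exists_tradeoff (X := Quantity qbar) (f := fun x => π x q)
    (g := fun x => π q x) (r := r)
    (hc.comp (f := fun x : Quantity qbar => (x, q)) (by fun_prop))
    (hc.comp (f := fun x : Quantity qbar => (q, x)) (by fun_prop))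
    (fun x => (hR ql hql.1).2 x.2)
    (fun x hx => Subtype.ext (hπ.eq_of_isMaxOn x.2 r.2 hql.1
      (fun y hy => ((hR ql hql.1).2 hy).trans_eq hx.symm) (hR ql hql.1).2))
    (show 0 < ε / 3 by positivity)
  -- With ω = η the regret is below 3η. The total loss ε/3 + 3Kη + η is then at most 2ε/3.
  set η : ℝ := ε / (9 * (K + 1)) with hηdef
  have hη : 0 < η := by positivity
  have hηK : (K + 1) * (3 * η) = ε / 3 := by rw [hηdef]; field_simp; norm_num
  obtain ⟨δ, hδpos, hmod⟩ := exists_modulus hc hη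
  refine ⟨δ, hδpos, fun g g0 g1 hg hδ μ h hd m ⟨hm, u, hu, hlim, hreach, hopt⟩ R' ql' hR' hql' => ?_⟩
  have hR'R : R' ql' = R ql' := hπ.eq_of_isMaxOn (hR' ql' hql'.1).1 (hR ql' hql'.1).1 hql'.1
    (hR' ql' hql'.1).2 (hR ql' hql'.1).2
  have hle : π ql' (R' ql') ≤ π q r := by
    rw [hR'R]
    exact hql.2 hql'.1
  refine ge_of_tendsto (tendsto_leaderPayoff hd hc hu hm hlim) ?_
  filter_upwards [hopt η hη] with n ⟨hlead, hfol⟩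
  obtain ⟨β, hβm, hβ⟩ := hu n
  have hae := ae_integral_regret_neg (r := r) hd hg hc hδ (hmod q) hβ (hreach n) hfol
  have hint : ∀ {f : Quantity qbar → ℝ} (s : ℝ), Continuous f → Integrable f (β s) := fun s hf =>
    BoundedContinuousFunction.integrable _ (BoundedContinuousFunction.mkOfCompact ⟨_, hf⟩)
  have hx : Continuous fun x : Quantity qbar => π x q :=
    hc.comp (f := fun x : Quantity qbar => (x, q)) (by fun_prop)
  have hx' : Continuous fun x : Quantity qbar => π q x :=
    hc.comp (f := fun x : Quantity qbar => (q, x)) (by fun_prop)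
  have hdirac : π q r - ε / 3 - K * (3 * η) ≤
      leaderPayoff π h (diracProba q, (u n).2) := by
    refine le_leaderPayoff_dirac hd hg hc hβ ?_
    filter_upwards [hae] with s hs hpos
    have h1 := hs hpos
    have hreg : Integrable (fun x : Quantity qbar => π r q - π x q) (β s) :=
      hint s (continuous_const.sub hx)
    rw [integral_sub hreg (integrable_const _)] at h1
    simp only [integral_const, probReal_univ, one_smul] at h1
    -- The tradeoff is affine in the regret, so it can be integrated against the follower's mixed
    -- response.
    calc _ ≤ π q r - ε / 3 - K * ∫ x : Quantity qbar, (π r q - π x q) ∂(β s) := by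
          have := mul_le_mul_of_nonneg_left
            (show ∫ x : Quantity qbar, (π r q - π x q) ∂(β s) ≤ 3 * η by linarith) hK
          linarith
      _ = ∫ x : Quantity qbar, (π q r - ε / 3 - K * (π r q - π x q)) ∂(β s) := by
          rw [integral_sub (integrable_const _) (hreg.const_mul K), integral_const_mul]
          simp
      _ ≤ _ := integral_mono
          (hint s (continuous_const.sub (continuous_const.mul (continuous_const.sub hx)))) (hint s hx') htrade
  have hl := hlead (diracProba q)
  nlinarith
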